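/- **Theorem (offline completeness).** Let $E\subseteq\mathbb R^2$ be a measurable planar environment with measurable, pairwise disjoint subsets $S$ (starting region), $D$ (destination region) and $\Delta$ (obstacle region), where $S$ and $D$ are bounded, and suppose that every straight segment from a point of $S$ to a point of $D$ lies in $E$ (as is the case when $E$ is convex). Consider $n$ disk-shaped agents $A_1,\dots,A_n$ with radii $r_i>0$, initial positions $s_i\in S$ and destinations $d_i\in D$ (the positions of the centres). Put $\hat r=\max_i r_i$, let $B(x,\rho)$ be the closed disk with centre $x$ and radius $\rho$, and let $d_{\max}=\sup\{\|x-y\|_2 : x\in S,\ y\in D\}$. Assume that for all $i\ne j$ the disks $B(s_i,r_i)$ and $B(s_j,r_j)$ are at distance at least $2\hat r$ from each other, that each $B(s_i,r_i)$ is at distance at least $2\hat r$ from the boundary $\partial S$, and likewise for the disks $B(d_i,r_i)$ and $\partial D$. If the areas satisfy $$|E\setminus(\Delta\cup S\cup D)|\ \ge\ 2\,n\,d_{\max}\,\hat r ,$$ then there is a measurable obstacle region $\Delta^*\subseteq E\setminus(S\cup D)$ with the same area $|\Delta^*|=|\Delta|$ such that the following hold. Say that agent $A_i$ centred at $x$ is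 *clear* if the open disk of radius $r_i$ around $x$ lies in $E$, $x\notin\Delta^*$, and $\|x-w\|_2\ge r_i$ for all $w\in\partial\Delta^*$. 1. (Well-formedness.) For every $i$ there is a continuous path from $s_i$ to $d_i$ at all points $x$ of which $A_i$ is clear and $\|x-s_j\|_2\ge r_i+r_j$, $\|x-d_j\|_2\ge r_i+r_j$ for all $j\ne i$. 2. (All navigation tasks succeed.) There are continuous trajectories $p_i:[0,\infty)\to\mathbb R^2$ with $p_i(0)=s_i$, such that $p_i(t)=d_i$ for all sufficiently large $t$, $A_i$ centred at $p_i(t)$ is clear for all $t\ge0$, and $\|p_i(t)-p_j(t)\|_2\ge r_i+r_j$ for all $i\neq j$ and all $t\ge0$. 3. (Priority-based decentralized planning succeeds.) Suppose that the agents in some set $P\subseteq\{1,\dots,n\}$ have already chosen continuous trajectories from their initial positions to their destinations (reached in finite time and kept from then on), that all other agents rest at their initial positions, and that at all times every agent is clear and any two agents $A_j,A_k$ are at distance at least $r_j+r_k$ between centres. Then every agent $A_i$ with $i\notin P$ can also choose such a trajectory to its destination, so that the same holds for $P\cup\{i\}$ with the trajectories of all other agents unchanged. Hence planning one agent after another in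 any order never gets stuck. -/

import Mathlib

open MeasureTheory Metric Set
open scoped NNReal

namespace MultiAgent

/-- The Euclidean plane. -/
abbrev Plane : Type := EuclideanSpace ℝ (Fin 2)

/-- The maximal agent radius. -/
noncomputable def maxRadius {n : ℕ} (r : Fin n → ℝ) : ℝ := ⨆ i, r i

/-- The maximal (supremal) distance between a point of `S` and a point of `D`. -/
noncomputable def maxDist (S D : Set Plane) : ℝ :=
  sSup {ρ : ℝ | ∃ x ∈ S, ∃ y ∈ D, ρ = dist x y}

/-- The positions `c i`, one per agent, lie in the region `R`; the closed disks of radius `r i`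
around them (the agent bodies) are pairwise at distance at least twice the maximal radius, and
each of them is at distance at least twice the maximal radius from the boundary of `R`. -/
structure Spaced {n : ℕ} (r : Fin n → ℝ) (R : Set Plane) (c : Fin n → Plane) : Prop where
  mem : ∀ i, c i ∈ R
  apart : ∀ i j, i ≠ j → ∀ z ∈ closedBall (c i) (r i), ∀ w ∈ closedBall (c j) (r j),
    2 * maxRadius r ≤ dist z w
  boundary : ∀ i, ∀ z ∈ closedBall (c i) (r i), ∀ w ∈ frontier R, 2 * maxRadius r ≤ dist z w

/-- An agent of radius `ρ` centred at `x` stays inside the environment `E` and does not collide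
with the obstacle region `Δ`: its centre is outside `Δ` and at distance at least `ρ` from the
boundary of `Δ`. Touching a boundary is allowed. -/
def Clear (E Δ : Set Plane) (ρ : ℝ) (x : Plane) : Prop :=
  ball x ρ ⊆ E ∧ x ∉ Δ ∧ ∀ w ∈ frontier Δ, ρ ≤ dist x w

/-- The environment `E` with obstacle region `Δ` is well-formed for agents with radii `r`, initial
positions `s` and destinations `d`: each `s i` is joined to `d i` by a path inside `E` along which
agent `i` collides neither with `Δ` nor with another agent placed at its initial position or at
its destination. -/
def WellFormed {n : ℕ} (E Δ : Set Plane) (r : Fin n → ℝ) (s d : Fin n → Plane) : Prop :=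
  ∀ i, ∃ γ : Path (s i) (d i), ∀ τ, Clear E Δ (r i) (γ τ) ∧
    ∀ j, j ≠ i → r i + r j ≤ dist (γ τ) (s j) ∧ r i + r j ≤ dist (γ τ) (d j)

/-- Trajectories `p i : [0, ∞) → ℝ²` of all agents without any collision, in which the agents in
`P` travel from their initial positions to their destinations, which they reach in finite time and
where they stay, while all other agents rest at their initial positions. -/
structure IsPlan {n : ℕ} (E Δ : Set Plane) (r : Fin n → ℝ) (s d : Fin n → Plane)
    (P : Finset (Fin n)) (p : Fin n → ℝ≥0 → Plane) : Prop where
  continuous : ∀ i, Continuous (p i)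
  start : ∀ i, p i 0 = s i
  reach : ∀ i ∈ P, ∃ T : ℝ≥0, ∀ t, T ≤ t → p i t = d i
  rest : ∀ i, i ∉ P → ∀ t, p i t = s i
  clear : ∀ i t, Clear E Δ (r i) (p i t)
  apart : ∀ i j, i ≠ j → ∀ t, r i + r j ≤ dist (p i t) (p j t)

/-- All navigation tasks are carried out successfully without collision. -/
def Solves {n : ℕ} (E Δ : Set Plane) (r : Fin n → ℝ) (s d : Fin n → Plane)
    (p : Fin n → ℝ≥0 → Plane) : Prop :=
  IsPlan E Δ r s d Finset.univ p

/-- Priority-based (decentralized) planning never fails: whatever the order in which the agents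
plan, and whatever collision-free trajectories were chosen by the agents that have planned so far
(set `P`), any further agent `i` has a trajectory to its destination which collides neither with
`Δ`, nor with the trajectories already chosen, nor with the agents still at their initial
positions. -/
def PriorityPlanningSucceeds {n : ℕ} (E Δ : Set Plane) (r : Fin n → ℝ)
    (s d : Fin n → Plane) : Prop :=
  ∀ (P : Finset (Fin n)) (p : Fin n → ℝ≥0 → Plane), IsPlan E Δ r s d P p →
    ∀ i, i ∉ P → ∃ q : ℝ≥0 → Plane, IsPlan E Δ r s d (insert i P) (Function.update p i q)

end MultiAgent

/-!
The obstacles are moved out of the way of `n` straight corridors, one for each agent.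

* The spacing condition makes the disk of radius `r i + 2 * maxRadius r` around `s i` a subset of
  `S`, and likewise for `d i` and `D` (`Spaced.ball_subset`). All these enlarged disks are free of
  obstacles whatever obstacle region outside `S ∪ D` is chosen.
* What agent `i` sweeps when it moves straight from `s i` to `d i` is covered by the disks around
  the endpoints, which lie in `S ∪ D`, and by a rectangle with sides `dist (s i) (d i)` and
  `2 * r i`. The `n` rectangles together have area at most `2 * n * maxDist S D * maxRadius r`, so
  enough room remains outside them and outside `S ∪ D` to place an obstacle region of the required
  area; Lebesgue measure takes all intermediate values on subsets (`exists_subset_volume_eq`).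
* The straight path of agent `i` may run into another agent resting at `s j` or `d j`. There it is
  pushed sideways onto the circle of radius `r i + r j` around that point
  (`exists_path_avoiding`). As `r i ≤ maxRadius r`, the agent stays inside the enlarged disk on
  this detour and keeps clear of all other agents. Hence the environment is well-formed.
* In a well-formed environment a new agent can wait at its initial position until all agents that
  have planned so far rest at their destinations, and then follow its path
  (`WellFormed.priorityPlanningSucceeds`). Planning the agents one by one in this way solves all
  navigation tasks.
-/

namespace MultiAgent

/-! ### Subsets of prescribed area -/

/-- Lebesgue measure on the plane takes on subsets of `A` every value up to `volume A`. A finite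
value is attained by the intersection of `A` with a disk around the origin, the area of this
intersection being a continuous function of the radius. -/
theorem exists_subset_volume_eq {A : Set Plane} (hA : MeasurableSet A) {a : ENNReal}
    (ha : a ≤ volume A) : ∃ B ⊆ A, MeasurableSet B ∧ volume B = a := by
  rcases ha.eq_or_lt with rfl | hlt
  · exact ⟨A, Subset.rfl, hA, rfl⟩
  have hfin : ∀ (X : Set Plane) (R : ℝ), volume (X ∩ closedBall 0 R) ≠ ⊤ := fun X R =>
    ((measure_mono inter_subset_right).trans_lt measure_closedBall_lt_top).ne
  have hcont : Continuous fun R : ℝ => volume.real (A ∩ closedBall (0 : Plane) (max R 0)) := by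
    have hg : Continuous fun R : ℝ => volume.real (closedBall (0 : Plane) (max R 0)) := by
      have : ∀ R : ℝ, volume.real (closedBall (0 : Plane) (max R 0)) =
          (max R 0) ^ Module.finrank ℝ Plane * volume.real (closedBall (0 : Plane) 1) :=
        fun R => Measure.addHaar_real_closedBall' volume 0 (le_max_right R 0)
      simp only [this]
      fun_prop
    have key : ∀ R R' : ℝ, R ≤ R' →
        dist (volume.real (A ∩ closedBall (0 : Plane) (max R 0)))
          (volume.real (A ∩ closedBall (0 : Plane) (max R' 0))) ≤
        dist (volume.real (closedBall (0 : Plane) (max R 0)))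
          (volume.real (closedBall (0 : Plane) (max R' 0))) := by
      intro R R' h
      have hsub : closedBall (0 : Plane) (max R 0) ⊆ closedBall 0 (max R' 0) :=
        closedBall_subset_closedBall (max_le_max_right 0 h)
      have h1 : volume.real (A ∩ closedBall (0 : Plane) (max R 0)) ≤
          volume.real (A ∩ closedBall (0 : Plane) (max R' 0)) :=
        measureReal_mono (inter_subset_inter_right A hsub) (hfin _ _)
      have h2 : volume.real (A ∩ closedBall (0 : Plane) (max R' 0)) ≤
          volume.real (A ∩ closedBall (0 : Plane) (max R 0)) +
            volume.real (closedBall (0 : Plane) (max R' 0) \ closedBall 0 (max R 0)) := by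
        refine (measureReal_mono ?_ ?_).trans (measureReal_union_le _ _)
        · intro p hp
          by_cases hq : p ∈ closedBall (0 : Plane) (max R 0)
          · exact Or.inl ⟨hp.1, hq⟩
          · exact Or.inr ⟨hp.2, hq⟩
        · exact (measure_union_lt_top (hfin _ _).lt_top
            ((measure_mono sdiff_subset).trans_lt measure_closedBall_lt_top)).ne
      have h3 : volume.real (closedBall (0 : Plane) (max R' 0) \ closedBall 0 (max R 0)) =
          volume.real (closedBall (0 : Plane) (max R' 0)) -
            volume.real (closedBall (0 : Plane) (max R 0)) :=
        measureReal_sdiff hsub measurableSet_closedBall measure_closedBall_lt_top.ne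
      rw [dist_comm, Real.dist_eq, dist_comm, Real.dist_eq, abs_of_nonneg (by linarith)]
      exact le_trans (by linarith) (le_abs_self _)
    rw [continuous_iff_continuousAt]
    intro R
    refine tendsto_iff_dist_tendsto_zero.2 (squeeze_zero (fun _ => dist_nonneg) (fun R' => ?_)
      (tendsto_iff_dist_tendsto_zero.1 (hg.tendsto R)))
    rcases le_total R' R with h | h
    · exact key _ _ h
    · rw [dist_comm, dist_comm (volume.real (closedBall (0 : Plane) (max R' 0)))]
      exact key _ _ h
  have hlim : Filter.Tendsto (fun k : ℕ => volume (A ∩ closedBall (0 : Plane) k)) Filter.atTop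
      (nhds (volume A)) := by
    have := tendsto_measure_iUnion_atTop (μ := (volume : Measure Plane))
      (s := fun k : ℕ => A ∩ closedBall (0 : Plane) k)
      (fun i j hij => inter_subset_inter_right A
        (closedBall_subset_closedBall (by exact_mod_cast hij)))
    rwa [← inter_iUnion, iUnion_closedBall_nat, inter_univ] at this
  obtain ⟨k, hk⟩ := (hlim.eventually (lt_mem_nhds hlt)).exists
  have hatop : a ≠ ⊤ := hlt.ne_top
  obtain ⟨R, -, hR⟩ := intermediate_value_Icc (Nat.cast_nonneg (α := ℝ) k) hcont.continuousOn
    (show a.toReal ∈ Icc _ _ by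
      constructor
      · have h0 : volume.real (A ∩ closedBall (0 : Plane) (max 0 0)) ≤ 0 := by
          refine (measureReal_mono inter_subset_right measure_closedBall_lt_top.ne).trans ?_
          simp [measureReal_def]
        exact h0.trans ENNReal.toReal_nonneg
      · simp only [Nat.cast_nonneg, max_eq_left]
        exact ENNReal.toReal_mono (hfin _ _) hk.le)
  refine ⟨A ∩ closedBall 0 (max R 0), inter_subset_left, hA.inter measurableSet_closedBall, ?_⟩
  exact (ENNReal.toReal_eq_toReal_iff' (hfin _ _) hatop).1 hR

/-! ### Corridors -/

/-- The closed rectangle with corners `x ± ρ • b 1` and `x + L • b 0 ± ρ • b 1`. -/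
def corridor (b : OrthonormalBasis (Fin 2) ℝ Plane) (x : Plane) (L ρ : ℝ) : Set Plane :=
  {p | b.repr (p - x) 0 ∈ Icc 0 L ∧ b.repr (p - x) 1 ∈ Icc (-ρ) ρ}

theorem measurableSet_corridor (b : OrthonormalBasis (Fin 2) ℝ Plane) (x : Plane) (L ρ : ℝ) :
    MeasurableSet (corridor b x L ρ) := by
  refine IsClosed.measurableSet ?_
  refine (isClosed_Icc.preimage ?_).inter (isClosed_Icc.preimage ?_) <;> fun_prop

theorem volume_corridor (b : OrthonormalBasis (Fin 2) ℝ Plane) (x : Plane) (L ρ : ℝ) :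
    volume (corridor b x L ρ) = ENNReal.ofReal L * ENNReal.ofReal (2 * ρ) := by
  have hmp : MeasurePreserving
      (fun p : Plane => WithLp.ofLp (b.repr (p - x))) volume volume :=
    (PiLp.volume_preserving_ofLp (Fin 2)).comp
      (b.measurePreserving_repr.comp (measurePreserving_sub_right volume x))
  have hset : corridor b x L ρ = (fun p : Plane => WithLp.ofLp (b.repr (p - x))) ⁻¹'
      (Set.Icc ![0, -ρ] ![L, ρ]) := by
    ext p
    simp only [corridor, mem_ofPred_eq, mem_preimage, mem_Icc, Pi.le_def, Fin.forall_fin_two,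
      Matrix.cons_val_zero, Matrix.cons_val_one]
    tauto
  rw [hset, hmp.measure_preimage measurableSet_Icc.nullMeasurableSet, Real.volume_Icc_pi,
    Fin.prod_univ_two]
  simp [two_mul]

/-- An orthonormal basis of the plane whose first vector points from `x` to `y`. -/
theorem exists_orthonormalBasis_direction (x y : Plane) :
    ∃ b : OrthonormalBasis (Fin 2) ℝ Plane, y - x = dist x y • b 0 := by
  by_cases h : y - x = 0
  · exact ⟨EuclideanSpace.basisFun (Fin 2) ℝ, by simp [dist_comm x y, dist_eq_norm, h]⟩
  · have hu : ‖(‖y - x‖⁻¹ • (y - x) : Plane)‖ = 1 := by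
      rw [norm_smul, norm_inv, norm_norm, inv_mul_cancel₀ (norm_ne_zero_iff.2 h)]
    obtain ⟨b, hb⟩ := Orthonormal.exists_orthonormalBasis_extension_of_card_eq (𝕜 := ℝ)
      (E := Plane) (ι := Fin 2) (by simp) (v := fun _ => ‖y - x‖⁻¹ • (y - x)) (s := {0})
      ⟨fun _ => hu, fun i j hij => (hij (Subsingleton.elim i j)).elim⟩
    refine ⟨b, ?_⟩
    rw [hb 0 rfl, dist_comm, dist_eq_norm, smul_smul, mul_inv_cancel₀ (norm_ne_zero_iff.2 h),
      one_smul]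

theorem dist_sq_eq_repr (b : OrthonormalBasis (Fin 2) ℝ Plane) (p q : Plane) :
    dist p q ^ 2 = b.repr (p - q) 0 ^ 2 + b.repr (p - q) 1 ^ 2 := by
  rw [dist_eq_norm, ← b.repr.norm_map, EuclideanSpace.norm_sq_eq, Fin.sum_univ_two]
  simp

/-- A disk whose centre moves straight from `x` to `y` sweeps a subset of the corridor and the two
disks around the endpoints. -/
theorem ball_subset_corridor {b : OrthonormalBasis (Fin 2) ℝ Plane} {x y z : Plane}
    (hb : y - x = dist x y • b 0) (hz : z ∈ segment ℝ x y) (ρ : ℝ) :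
    ball z ρ ⊆ corridor b x (dist x y) ρ ∪ ball x ρ ∪ ball y ρ := by
  intro p hp
  have hρ : 0 < ρ := pos_of_mem_ball hp
  rw [segment_eq_image'] at hz
  obtain ⟨θ, ⟨h0, h1⟩, rfl⟩ := hz
  rw [mem_ball] at hp
  have hL : 0 ≤ dist x y := dist_nonneg
  set L := dist x y with hLdef
  have hp2 : dist p (x + θ • (y - x)) ^ 2 < ρ ^ 2 := by gcongr
  rw [dist_sq_eq_repr b] at hp2
  have ez : p - (x + θ • (y - x)) = (p - x) - (θ * L) • b 0 := by rw [hb, smul_smul]; abel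
  have ey : p - y = (p - x) - L • b 0 := by rw [← hb]; abel
  rw [ez] at hp2
  simp only [map_sub, map_smul, b.repr_self, PiLp.sub_apply, PiLp.smul_apply,
    PiLp.single_apply, smul_eq_mul] at hp2
  norm_num at hp2
  have hx := dist_sq_eq_repr b p x
  have hy := dist_sq_eq_repr b p y
  rw [ey] at hy
  simp only [map_sub, map_smul, b.repr_self, PiLp.sub_apply, PiLp.smul_apply,
    PiLp.single_apply, smul_eq_mul] at hx hy
  norm_num at hx hy
  have hθL : θ * L ≤ L := mul_le_of_le_one_left hL h1
  have hθ0 : 0 ≤ θ * L := mul_nonneg h0 hL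
  simp only [corridor, mem_union, mem_ofPred_eq, mem_ball, mem_Icc, map_sub, PiLp.sub_apply]
  set α := b.repr p 0 - b.repr x 0
  set β := b.repr p 1 - b.repr x 1
  rcases lt_or_ge α 0 with hα | hα
  · exact Or.inl (Or.inr (lt_of_pow_lt_pow_left₀ 2 hρ.le (by nlinarith)))
  rcases lt_or_ge L α with hα' | hα'
  · exact Or.inr (lt_of_pow_lt_pow_left₀ 2 hρ.le (by nlinarith))
  exact Or.inl (Or.inl ⟨⟨hα, hα'⟩, abs_le.1 (abs_le_of_sq_le_sq (by nlinarith) hρ.le)⟩)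

/-! ### Detours around disks -/

/-- The length by which `p`, when it lies in the disk around `c` of radius `ρ`, has to be moved in
the direction of the unit vector `v` in order to reach the boundary circle; for `p` outside this
disk it is `0`, provided that `v` does not point towards `c`. -/
noncomputable def pushLength (c v : Plane) (ρ : ℝ) (p : Plane) : ℝ :=
  max 0 (-inner ℝ (p - c) v + √(inner ℝ (p - c) v ^ 2 + ρ ^ 2 - dist p c ^ 2))

theorem continuous_pushLength (c v : Plane) (ρ : ℝ) : Continuous (pushLength c v ρ) := by
  unfold pushLength
  fun_prop

theorem pushLength_eq_zero {c v p : Plane} {ρ : ℝ} (hρ : 0 ≤ ρ) (hv : 0 ≤ inner ℝ (p - c) v)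
    (hp : ρ ≤ dist p c) : pushLength c v ρ p = 0 := by
  refine max_eq_left ?_
  have : √(inner ℝ (p - c) v ^ 2 + ρ ^ 2 - dist p c ^ 2) ≤ inner ℝ (p - c) v :=
    Real.sqrt_le_iff.2 ⟨hv, by nlinarith⟩
  linarith

theorem dist_add_pushLength {c v p : Plane} {ρ : ℝ} (hρ : 0 ≤ ρ) (hv : ‖v‖ = 1)
    (hp : dist p c ≤ ρ) :
    dist (p + pushLength c v ρ p • v) c = ρ := by
  have hsq : 0 ≤ ρ ^ 2 - dist p c ^ 2 := by nlinarith [dist_nonneg (x := p) (y := c)]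
  have hle : inner ℝ (p - c) v ≤ √(inner ℝ (p - c) v ^ 2 + ρ ^ 2 - dist p c ^ 2) :=
    Real.le_sqrt_of_sq_le (by linarith)
  have hs := Real.sq_sqrt (show 0 ≤ inner ℝ (p - c) v ^ 2 + ρ ^ 2 - dist p c ^ 2 by
    nlinarith [sq_nonneg (inner ℝ (p - c) v)])
  have hl : pushLength c v ρ p =
      -inner ℝ (p - c) v + √(inner ℝ (p - c) v ^ 2 + ρ ^ 2 - dist p c ^ 2) :=
    max_eq_right (by linarith)
  rw [hl]
  set σ := √(inner ℝ (p - c) v ^ 2 + ρ ^ 2 - dist p c ^ 2)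
  have h2 : dist (p + (-inner ℝ (p - c) v + σ) • v) c ^ 2 = ρ ^ 2 := by
    rw [dist_eq_norm, add_sub_right_comm, norm_add_sq_real, inner_smul_right, norm_smul, hv,
      ← dist_eq_norm, mul_one, Real.norm_eq_abs, sq_abs]
    linear_combination hs
  exact (pow_left_inj₀ dist_nonneg hρ two_ne_zero).1 h2

/-- Given finitely many disks with disjoint interiors, two points outside are joined by a path that
follows the straight segment where this is outside all of the disks, and runs along the boundary
circle of a disk elsewhere. -/
theorem exists_path_avoiding {ι : Type*} [Fintype ι] (x y : Plane) (c : ι → Plane) (ρ : ι → ℝ)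
    (hρ : ∀ a, 0 ≤ ρ a) (hdisj : ∀ a b, a ≠ b → ρ a + ρ b ≤ dist (c a) (c b))
    (hx : ∀ a, ρ a ≤ dist x (c a)) (hy : ∀ a, ρ a ≤ dist y (c a)) :
    ∃ γ : Path x y, ∀ τ, (∀ a, ρ a ≤ dist (γ τ) (c a)) ∧
      (γ τ ∈ segment ℝ x y ∨ ∃ a, dist (γ τ) (c a) = ρ a) := by
  classical
  -- A normal vector of the segment, with the sign for which it points away from the centre `c a`.
  have hv : ∀ a, ∃ v : Plane, ‖v‖ = 1 ∧
      ∀ t : ℝ, 0 ≤ inner ℝ (AffineMap.lineMap x y t - c a) v := by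
    intro a
    obtain ⟨b, hb⟩ := exists_orthonormalBasis_direction x y
    have horth : inner ℝ (b 0) (b 1) = (0 : ℝ) := b.orthonormal.2 (by decide)
    have hconst : ∀ t : ℝ,
        inner ℝ (AffineMap.lineMap x y t - c a) (b 1) = inner ℝ (x - c a) (b 1) := by
      intro t
      rw [AffineMap.lineMap_apply_module', hb, add_sub_assoc, inner_add_left, inner_smul_left,
        inner_smul_left, horth]
      simp
    rcases le_total 0 (inner ℝ (x - c a) (b 1)) with h | h
    · exact ⟨b 1, b.orthonormal.1 1, fun t => (hconst t).symm ▸ h⟩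
    · refine ⟨-b 1, by rw [norm_neg]; exact b.orthonormal.1 1, fun t => ?_⟩
      rw [inner_neg_right, hconst t]
      linarith
  choose v hv1 hv0 using hv
  let f : ℝ → Plane := fun t => AffineMap.lineMap x y t +
    ∑ a, pushLength (c a) (v a) (ρ a) (AffineMap.lineMap x y t) • v a
  have hfc : Continuous f := by
    refine AffineMap.lineMap_continuous.add (continuous_finsetSum _ fun a _ => ?_)
    exact ((continuous_pushLength _ _ _).comp AffineMap.lineMap_continuous).smul continuous_const
  have hout : ∀ t : ℝ, (∀ a, ρ a ≤ dist (AffineMap.lineMap x y t) (c a)) →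
      f t = AffineMap.lineMap x y t := by
    intro t ht
    simp only [f, add_eq_left]
    exact Finset.sum_eq_zero fun a _ => by
      rw [pushLength_eq_zero (hρ a) (hv0 a t) (ht a), zero_smul]
  have hin : ∀ (t : ℝ) (a), dist (AffineMap.lineMap x y t) (c a) < ρ a →
      dist (f t) (c a) = ρ a := by
    intro t a ha
    have hsum : ∑ a, pushLength (c a) (v a) (ρ a) (AffineMap.lineMap x y t) • v a =
        pushLength (c a) (v a) (ρ a) (AffineMap.lineMap x y t) • v a := by
      refine Finset.sum_eq_single a (fun b _ hba => ?_) (by simp)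
      rw [pushLength_eq_zero (hρ b) (hv0 b t) ?_, zero_smul]
      have := dist_triangle_left (c a) (c b) (AffineMap.lineMap x y t)
      linarith [hdisj a b hba.symm]
    simp only [f, hsum]
    exact dist_add_pushLength (hρ a) (hv1 a) ha.le
  refine ⟨⟨⟨fun t => f t, hfc.comp continuous_subtype_val⟩, ?_, ?_⟩, fun τ => ?_⟩
  · have := hout 0 (by simpa using hx)
    simpa using this
  · have := hout 1 (by simpa using hy)
    simpa using this
  · change (∀ a, ρ a ≤ dist (f τ) (c a)) ∧ (f τ ∈ segment ℝ x y ∨ ∃ a, dist (f τ) (c a) = ρ a)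
    by_cases h : ∀ a, ρ a ≤ dist (AffineMap.lineMap x y (τ : ℝ)) (c a)
    · rw [hout τ h]
      exact ⟨h, Or.inl (segment_eq_image_lineMap ℝ x y ▸ mem_image_of_mem _ τ.2)⟩
    · push Not at h
      obtain ⟨a, ha⟩ := h
      have hfa := hin τ a ha
      refine ⟨fun b => ?_, Or.inr ⟨a, hfa⟩⟩
      by_cases hba : b = a
      · rw [hba, hfa]
      · have := dist_triangle_left (c a) (c b) (f τ)
        linarith [hdisj a b (Ne.symm hba)]

/-! ### Consequences of the spacing condition -/

theorem le_maxRadius {n : ℕ} (r : Fin n → ℝ) (i : Fin n) : r i ≤ maxRadius r :=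
  le_ciSup (finite_range r).bddAbove i

theorem dist_le_maxDist {S D : Set Plane} (hS : Bornology.IsBounded S)
    (hD : Bornology.IsBounded D) {x y : Plane} (hx : x ∈ S) (hy : y ∈ D) :
    dist x y ≤ maxDist S D := by
  refine le_csSup ⟨diam (S ∪ D), ?_⟩ ⟨x, hx, y, hy, rfl⟩
  rintro _ ⟨a, ha, b, hb, rfl⟩
  exact dist_le_diam_of_mem (hS.union hD) (Or.inl ha) (Or.inr hb)

theorem clear_of_ball {E Δ : Set Plane} {ρ : ℝ} {x : Plane} (hρ : 0 < ρ) (hE : ball x ρ ⊆ E)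
    (hΔ : Disjoint (ball x ρ) Δ) : Clear E Δ ρ x := by
  refine ⟨hE, disjoint_left.1 hΔ (mem_ball_self hρ), fun w hw => ?_⟩
  by_contra! hlt
  obtain ⟨z, hz, hzΔ⟩ := mem_closure_iff.1 (frontier_subset_closure hw) _ isOpen_ball
    (mem_ball'.2 hlt)
  exact disjoint_left.1 hΔ hz hzΔ

namespace Spaced

variable {n : ℕ} {r : Fin n → ℝ} {R : Set Plane} {c : Fin n → Plane}

theorem ball_subset (h : Spaced r R c) (hr : ∀ i, 0 < r i) (i : Fin n) :
    ball (c i) (r i + 2 * maxRadius r) ⊆ R := by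
  have hpos : 0 < maxRadius r := (hr i).trans_le (le_maxRadius r i)
  have hfr : ∀ w ∈ ball (c i) (r i + 2 * maxRadius r), w ∉ frontier R := by
    intro w hw hwR
    rw [add_comm, ← thickening_closedBall (by positivity) (hr i).le, mem_thickening_iff] at hw
    obtain ⟨z, hz, hwz⟩ := hw
    rw [dist_comm] at hwz
    exact hwz.not_ge (h.boundary i z hz w hwR)
  have hc : c i ∈ ball (c i) (r i + 2 * maxRadius r) := mem_ball_self (by linarith [hr i])
  have hint : ball (c i) (r i + 2 * maxRadius r) ⊆ interior R := by
    refine (convex_ball _ _).isPreconnected.subset_left_of_subset_union isOpen_interior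
      isClosed_closure.isOpen_compl
      (disjoint_compl_right.mono_left (interior_subset.trans subset_closure)) ?_ ⟨c i, hc, ?_⟩
    · intro w hw
      by_cases hwR : w ∈ closure R
      · exact Or.inl (by_contra fun hwi => hfr w hw ⟨hwR, hwi⟩)
      · exact Or.inr hwR
    · exact by_contra fun hci => hfr _ hc ⟨subset_closure (h.mem i), hci⟩
  exact hint.trans interior_subset

theorem le_dist (h : Spaced r R c) (hr : ∀ i, 0 < r i) {i j : Fin n} (hij : i ≠ j) :
    r i + r j + 2 * maxRadius r ≤ dist (c i) (c j) := by
  have hpos : 0 < maxRadius r := (hr i).trans_le (le_maxRadius r i)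
  have hdisj : Disjoint (ball (c i) (2 * maxRadius r + r i)) (closedBall (c j) (r j)) := by
    rw [← thickening_closedBall (by positivity) (hr i).le, disjoint_left]
    intro w hw hwj
    obtain ⟨z, hz, hwz⟩ := mem_thickening_iff.1 hw
    rw [dist_comm] at hwz
    exact hwz.not_ge (h.apart i j hij z hz w hwj)
  have := (disjoint_ball_closedBall_iff (by linarith [hr i]) (hr j).le).1 hdisj
  linarith

theorem le_dist_of_disjoint {R' : Set Plane} {c' : Fin n → Plane} (h : Spaced r R c)
    (h' : Spaced r R' c') (hr : ∀ i, 0 < r i) (hR : Disjoint R R') (i j : Fin n) :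
    r i + r j + 4 * maxRadius r ≤ dist (c i) (c' j) := by
  have hpos : 0 < maxRadius r := (hr i).trans_le (le_maxRadius r i)
  have := (disjoint_ball_ball_iff (by linarith [hr i]) (by linarith [hr j])).1
    (hR.mono (h.ball_subset hr i) (h'.ball_subset hr j))
  linarith

end Spaced

/-! ### Well-formedness -/

/-- An obstacle region outside `S ∪ D` that leaves the straight corridors of all agents free makes
the environment well-formed. -/
theorem wellFormed_of_disjoint_corridor {n : ℕ} {E S D Δ : Set Plane} {r : Fin n → ℝ}
    {s d : Fin n → Plane} (hSE : S ⊆ E) (hDE : D ⊆ E) (hSD : Disjoint S D)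
    (hseg : ∀ x ∈ S, ∀ y ∈ D, segment ℝ x y ⊆ E) (hr : ∀ i, 0 < r i)
    (hs : Spaced r S s) (hd : Spaced r D d) (hSΔ : Disjoint S Δ) (hDΔ : Disjoint D Δ)
    {b : Fin n → OrthonormalBasis (Fin 2) ℝ Plane}
    (hb : ∀ i, d i - s i = dist (s i) (d i) • b i 0)
    (hΔ : ∀ i, Disjoint (corridor (b i) (s i) (dist (s i) (d i)) (r i)) Δ) :
    WellFormed E Δ r s d := by
  intro i
  have hri := le_maxRadius r i
  have hri0 := hr i
  have hsd : ∀ j k, r j + r k + 4 * maxRadius r ≤ dist (s j) (d k) :=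
    hs.le_dist_of_disjoint hd hr hSD
  obtain ⟨γ, hγ⟩ := exists_path_avoiding (ι := {j // j ≠ i} ⊕ {j // j ≠ i}) (s i) (d i)
    (Sum.elim (fun j => s j) (fun j => d j)) (Sum.elim (fun j => r i + r j) (fun j => r i + r j))
    (by rintro (j | j) <;> simpa using (add_pos (hr i) (hr j)).le)
    (by
      rintro (⟨j, hj⟩ | ⟨j, hj⟩) (⟨k, hk⟩ | ⟨k, hk⟩) hjk <;> simp only [Sum.elim_inl, Sum.elim_inr]
      · have := hs.le_dist hr (i := j) (j := k) (by rintro rfl; exact hjk rfl)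
        linarith
      · linarith [hsd j k]
      · rw [dist_comm]
        linarith [hsd k j]
      · have := hd.le_dist hr (i := j) (j := k) (by rintro rfl; exact hjk rfl)
        linarith)
    (by
      rintro (⟨j, hj⟩ | ⟨j, hj⟩) <;> simp only [Sum.elim_inl, Sum.elim_inr]
      · linarith [hs.le_dist hr hj.symm]
      · linarith [hsd i j])
    (by
      rintro (⟨j, hj⟩ | ⟨j, hj⟩) <;> simp only [Sum.elim_inl, Sum.elim_inr]
      · rw [dist_comm]
        linarith [hsd j i]
      · linarith [hd.le_dist hr hj.symm])
  -- On the circle around `s j` or `d j` the body of agent `i` stays inside the enlarged disk.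
  have hdetour : ∀ {R : Set Plane} {c : Fin n → Plane}, R ⊆ E → Disjoint R Δ → Spaced r R c →
      ∀ (j : Fin n) (x : Plane), dist x (c j) = r i + r j → Clear E Δ (r i) x := by
    intro R c hRE hRΔ hc j x hx
    have hsub : ball x (r i) ⊆ R :=
      (ball_subset_ball' (by linarith)).trans (hc.ball_subset hr j)
    exact clear_of_ball hri0 (hsub.trans hRE) (hRΔ.mono_left hsub)
  refine ⟨γ, fun τ => ⟨?_, fun j hj => ⟨?_, ?_⟩⟩⟩
  · rcases (hγ τ).2 with hτ | ⟨⟨j, hj⟩ | ⟨j, hj⟩, hτ⟩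
    · have hsb : ball (s i) (r i) ⊆ S :=
        (ball_subset_ball (by linarith)).trans (hs.ball_subset hr i)
      have hdb : ball (d i) (r i) ⊆ D :=
        (ball_subset_ball (by linarith)).trans (hd.ball_subset hr i)
      refine clear_of_ball hri0 ?_ ?_
      · -- A point of the disk lies on the translate of the segment by its offset from the centre.
        intro p hp
        obtain ⟨t, ht, htτ⟩ := (segment_eq_image' ℝ (s i) (d i)) ▸ hτ
        have hnorm : ‖p - γ τ‖ < r i := by rwa [← dist_eq_norm]
        refine hseg (s i + (p - γ τ)) (hsb (by simpa using hnorm)) (d i + (p - γ τ))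
          (hdb (by simpa using hnorm)) ?_
        rw [segment_eq_image']
        refine ⟨t, ht, ?_⟩
        have : d i + (p - γ τ) - (s i + (p - γ τ)) = d i - s i := by abel
        simp only at htτ ⊢
        rw [this, add_right_comm, htτ]
        abel
      · refine Disjoint.mono_left (ball_subset_corridor (hb i) hτ (r i)) ?_
        exact ((hΔ i).union_left (hSΔ.mono_left hsb)).union_left (hDΔ.mono_left hdb)
    · exact hdetour hSE hSΔ hs j _ hτ
    · exact hdetour hDE hDΔ hd j _ hτ
  · exact (hγ τ).1 (Sum.inl ⟨j, hj⟩)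
  · exact (hγ τ).1 (Sum.inr ⟨j, hj⟩)

/-! ### Planning in well-formed environments -/

theorem WellFormed.priorityPlanningSucceeds {n : ℕ} {E Δ : Set Plane} {r : Fin n → ℝ}
    {s d : Fin n → Plane} (h : WellFormed E Δ r s d) : PriorityPlanningSucceeds E Δ r s d := by
  intro P p hp i hi
  obtain ⟨γ, hγ⟩ := h i
  -- A time `T` from which on all agents in `P` rest at their destinations.
  obtain ⟨T, hT⟩ : ∃ T : ℝ≥0, ∀ j ∈ P, ∀ t, T ≤ t → p j t = d j := by
    choose! T hT using hp.reach
    exact ⟨P.sup T, fun j hj t ht => hT j hj t ((Finset.le_sup hj).trans ht)⟩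
  have hrange : ∀ u : ℝ, ∃ τ, γ.extend u = γ τ := fun u => ⟨_, rfl⟩
  have hrest : ∀ t : ℝ≥0, t ≤ T → γ.extend ((t : ℝ) - T) = s i := fun t ht =>
    γ.extend_of_le_zero (sub_nonpos.2 (by exact_mod_cast ht))
  have happart : ∀ j, j ≠ i → ∀ t : ℝ≥0, r i + r j ≤ dist (γ.extend ((t : ℝ) - T)) (p j t) := by
    intro j hj t
    rcases le_total t T with ht | ht
    · rw [hrest t ht, ← hp.rest i hi t]
      exact hp.apart i j hj.symm t
    · obtain ⟨τ, hτ⟩ := hrange ((t : ℝ) - T)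
      rw [hτ]
      by_cases hjP : j ∈ P
      · rw [hT j hjP t ht]
        exact ((hγ τ).2 j hj).2
      · rw [hp.rest j hjP t]
        exact ((hγ τ).2 j hj).1
  refine ⟨fun t => γ.extend ((t : ℝ) - T), ?_, ?_, ?_, ?_, ?_, ?_⟩
  · intro j
    by_cases hj : j = i
    · subst hj
      simp only [Function.update_self]
      exact γ.continuous_extend.comp (by fun_prop)
    · simpa only [Function.update_of_ne hj] using hp.continuous j
  · intro j
    by_cases hj : j = i
    · subst hj
      simp only [Function.update_self]
      exact hrest 0 zero_le
    · simpa only [Function.update_of_ne hj] using hp.start j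
  · intro j hjP
    by_cases hj : j = i
    · subst hj
      refine ⟨T + 1, fun t ht => ?_⟩
      simp only [Function.update_self]
      refine γ.extend_of_one_le ?_
      have : (T : ℝ) + 1 ≤ t := by exact_mod_cast ht
      linarith
    · simpa only [Function.update_of_ne hj] using
        hp.reach j (Finset.mem_of_mem_insert_of_ne hjP hj)
  · intro j hjP t
    rw [Finset.mem_insert, not_or] at hjP
    simpa only [Function.update_of_ne hjP.1] using hp.rest j hjP.2 t
  · intro j t
    by_cases hj : j = i
    · subst hj
      simp only [Function.update_self]
      obtain ⟨τ, hτ⟩ := hrange ((t : ℝ) - T)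
      rw [hτ]
      exact (hγ τ).1
    · simpa only [Function.update_of_ne hj] using hp.clear j t
  · intro j k hjk t
    by_cases hj : j = i
    · subst hj
      simpa only [Function.update_self, Function.update_of_ne hjk.symm] using happart k hjk.symm t
    · by_cases hk : k = i
      · subst hk
        simp only [Function.update_self, Function.update_of_ne hj]
        rw [dist_comm, add_comm]
        exact happart j hj t
      · simpa only [Function.update_of_ne hj, Function.update_of_ne hk] using hp.apart j k hjk t

/-- If priority-based planning never gets stuck, then it ends with a solution, provided that it
can start: all agents are clear and apart at their initial positions. -/
theorem PriorityPlanningSucceeds.exists_solves {n : ℕ} {E Δ : Set Plane} {r : Fin n → ℝ}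
    {s d : Fin n → Plane} (h : PriorityPlanningSucceeds E Δ r s d)
    (hclear : ∀ i, Clear E Δ (r i) (s i))
    (hapart : ∀ i j, i ≠ j → r i + r j ≤ dist (s i) (s j)) :
    ∃ p : Fin n → ℝ≥0 → Plane, Solves E Δ r s d p := by
  have hplan : ∀ P : Finset (Fin n), ∃ p, IsPlan E Δ r s d P p := by
    intro P
    induction P using Finset.induction_on with
    | empty =>
      exact ⟨fun i _ => s i, fun _ => continuous_const, fun _ => rfl, by simp, fun _ _ _ => rfl,
        fun i _ => hclear i, fun i j hij _ => hapart i j hij⟩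
    | insert i P hi ih =>
      obtain ⟨p, hp⟩ := ih
      obtain ⟨q, hq⟩ := h P p hp i hi
      exact ⟨_, hq⟩
  exact hplan Finset.univ

end MultiAgent

theorem theorem1 (n : ℕ) (E S D Δ : Set MultiAgent.Plane)
    (r : Fin n → ℝ) (s d : Fin n → MultiAgent.Plane)
    (hEm : MeasurableSet E) (hSm : MeasurableSet S) (hDm : MeasurableSet D)
    (hΔm : MeasurableSet Δ)
    (hSE : S ⊆ E) (hDE : D ⊆ E) (hΔE : Δ ⊆ E)
    (hSD : Disjoint S D) (hSΔ : Disjoint S Δ) (hDΔ : Disjoint D Δ)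
    (hSb : Bornology.IsBounded S) (hDb : Bornology.IsBounded D)
    (hseg : ∀ x ∈ S, ∀ y ∈ D, segment ℝ x y ⊆ E)
    (hr : ∀ i, 0 < r i)
    (hs : MultiAgent.Spaced r S s) (hd : MultiAgent.Spaced r D d)
    (harea : ENNReal.ofReal (2 * n * MultiAgent.maxDist S D * MultiAgent.maxRadius r)
      ≤ volume (E \ (Δ ∪ S ∪ D))) :
    ∃ Δ' : Set MultiAgent.Plane,
      MeasurableSet Δ' ∧ Δ' ⊆ E ∧ Disjoint S Δ' ∧ Disjoint D Δ' ∧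
      volume Δ' = volume Δ ∧
      MultiAgent.WellFormed E Δ' r s d ∧
      (∃ p : Fin n → ℝ≥0 → MultiAgent.Plane, MultiAgent.Solves E Δ' r s d p) ∧
      MultiAgent.PriorityPlanningSucceeds E Δ' r s d := by
  open MultiAgent in
  choose b hb using fun i => exists_orthonormalBasis_direction (s i) (d i)
  let C : Set Plane := ⋃ i, corridor (b i) (s i) (dist (s i) (d i)) (r i)
  have hCm : MeasurableSet C := MeasurableSet.iUnion fun i => measurableSet_corridor _ _ _ _
  have hCvol : volume C ≤ ENNReal.ofReal (2 * n * maxDist S D * maxRadius r) := by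
    have hone : ∀ i, volume (corridor (b i) (s i) (dist (s i) (d i)) (r i)) ≤
        ENNReal.ofReal (2 * maxDist S D * maxRadius r) := by
      intro i
      rw [volume_corridor, ← ENNReal.ofReal_mul dist_nonneg]
      refine ENNReal.ofReal_le_ofReal ?_
      have h1 := dist_le_maxDist hSb hDb (hs.mem i) (hd.mem i)
      have h2 := le_maxRadius r i
      calc dist (s i) (d i) * (2 * r i) ≤ maxDist S D * (2 * maxRadius r) :=
            mul_le_mul h1 (by linarith) (by linarith [hr i]) (dist_nonneg.trans h1)
        _ = 2 * maxDist S D * maxRadius r := by ring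
    calc volume C ≤ ∑ i, volume (corridor (b i) (s i) (dist (s i) (d i)) (r i)) :=
          measure_iUnion_fintype_le _ _
      _ ≤ ∑ _i : Fin n, ENNReal.ofReal (2 * maxDist S D * maxRadius r) :=
          Finset.sum_le_sum fun i _ => hone i
      _ = ENNReal.ofReal (2 * n * maxDist S D * maxRadius r) := by
          rw [Finset.sum_const, Finset.card_univ, Fintype.card_fin, ← ENNReal.ofReal_nsmul,
            nsmul_eq_mul]
          ring_nf
  have hroom : volume Δ ≤ volume (E \ (S ∪ D ∪ C)) := by
    have hCtop : volume C ≠ ⊤ := (hCvol.trans_lt ENNReal.ofReal_lt_top).ne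
    refine (ENNReal.add_le_add_iff_right hCtop).1 ?_
    calc volume Δ + volume C ≤ volume Δ + volume (E \ (Δ ∪ S ∪ D)) :=
          add_le_add_right (hCvol.trans harea) _
      _ = volume (Δ ∪ E \ (Δ ∪ S ∪ D)) :=
          (measure_union (disjoint_sdiff_right.mono_left
            (subset_union_left.trans subset_union_left))
            (hEm.diff ((hΔm.union hSm).union hDm))).symm
      _ ≤ volume (E \ (S ∪ D ∪ C) ∪ C) := by
          refine measure_mono (union_subset (fun p hp => ?_) fun p hp => ?_)
          · by_cases hpC : p ∈ C
            · exact Or.inr hpC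
            · refine Or.inl ⟨hΔE hp, ?_⟩
              rintro ((h | h) | h)
              exacts [disjoint_left.1 hSΔ h hp, disjoint_left.1 hDΔ h hp, hpC h]
          · by_cases hpC : p ∈ C
            · exact Or.inr hpC
            · refine Or.inl ⟨hp.1, ?_⟩
              rintro ((h | h) | h)
              exacts [hp.2 (Or.inl (Or.inr h)), hp.2 (Or.inr h), hpC h]
      _ ≤ volume (E \ (S ∪ D ∪ C)) + volume C := measure_union_le _ _
  obtain ⟨Δ', hsub, hΔ'm, hvol⟩ :=
    exists_subset_volume_eq (hEm.diff ((hSm.union hDm).union hCm)) hroom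
  have hfree : Disjoint (S ∪ D ∪ C) Δ' := disjoint_sdiff_right.mono_right hsub
  have hS : Disjoint S Δ' := hfree.mono_left (subset_union_left.trans subset_union_left)
  have hD : Disjoint D Δ' := hfree.mono_left (subset_union_right.trans subset_union_left)
  have hwf : WellFormed E Δ' r s d :=
    wellFormed_of_disjoint_corridor hSE hDE hSD hseg hr hs hd hS hD hb fun i =>
      hfree.mono_left ((subset_iUnion
        (fun i => corridor (b i) (s i) (dist (s i) (d i)) (r i)) i).trans subset_union_right)
  refine ⟨Δ', hΔ'm, hsub.trans sdiff_subset, hS, hD, hvol, hwf, ?_,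
    hwf.priorityPlanningSucceeds⟩
  refine hwf.priorityPlanningSucceeds.exists_solves (fun i => ?_) fun i j hij => ?_
  · obtain ⟨γ, hγ⟩ := hwf i
    simpa using (hγ 0).1
  · linarith [hs.le_dist hr hij, hr i, le_maxRadius r i]
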